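/- Let $K$ be a field and let $P$ be a finite meet-semilattice, i.e. a finite poset in which any two elements $x,y$ have an infimum $x\wedge y$ (no greatest element is required). Let $I(P,K)$ be the incidence algebra of $P$, with basis $f_{xy}$ ($x\le y$) and $f_{xy}f_{yz}=f_{xz}$, and for $x\in P$ let $P(x)=I(P,K)f_{xx}$ be the corresponding indecomposable projective left module. For left $I(P,K)$-modules $M,N$ let $M\otimes N$ be the pointwise tensor product: $M\otimes N=\bigoplus_{x\in P} M_x\otimes_K N_x$ with $M_x=f_{xx}M$, on which $f_{xy}$ acts as $f_{xy}\otimes f_{xy}:M_y\otimes_K N_y\to M_x\otimes_K N_x$. Let $K_0(P)$ be the Grothendieck group of finitely generated projective left $I(P,K)$-modules. Then: 1. $P(x)\otimes P(y)\cong P(x\wedge y)$ for all $x,y\in P$; 2. $K_0(P)$ is closed under tensor products: if $M$ and $N$ are finitely generated projective, then so is $M\otimes N$; 3. the group $K_0(P)$ is a commutative ring with identity under the multiplication induced by $[M][N]=[M\otimes N]$, and there is a ring isomorphism from the semigroup ring $\mathbb Z[P,\wedge]$ to $K_0(P)$ that sends each $x\in P$ to $[P(x)]$. Dually, if $Q$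 is a finite join-semilattice, then the same holds for the opposite poset $Q^{\mathrm{op}}$ and the operation $\vee$: over $I(Q^{\mathrm{op}},K)$ one has $P(x)\otimes P(y)\cong P(x\vee y)$, the group $K_0(Q^{\mathrm{op}})$ is closed under tensor products, it is a commutative ring with identity, and $x\mapsto [P(x)]$ induces a ring isomorphism $\mathbb Z[Q,\vee]\cong K_0(Q^{\mathrm{op}})$. -/

import Mathlib

open scoped TensorProduct

universe u v

/-! ### The Grothendieck group `K₀` of a ring -/

/-- A finitely generated projective left `R`-module. -/
structure FGProj (R : Type u) [Ring R] where
  carrier : Type u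
  [addCommGroup : AddCommGroup carrier]
  [module : Module R carrier]
  [finite : Module.Finite R carrier]
  [projective : Module.Projective R carrier]

namespace FGProj

attribute [instance] FGProj.addCommGroup FGProj.module FGProj.finite FGProj.projective

variable (R : Type u) [Ring R]

/-- Two finitely generated projective modules are equivalent when they are isomorphic. -/
instance isoSetoid : Setoid (FGProj R) where
  r M N := Nonempty (M.carrier ≃ₗ[R] N.carrier)
  iseqv :=
    { refl := fun M => ⟨LinearEquiv.refl R M.carrier⟩
      symm := fun ⟨e⟩ => ⟨e.symm⟩
      trans := fun ⟨e⟩ ⟨f⟩ => ⟨e.trans f⟩ }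

/-- The set of isomorphism classes of finitely generated projective left `R`-modules. -/
def IsoClass : Type (u + 1) := Quotient (isoSetoid R)

/-- The direct sum of isomorphism classes. -/
instance : Add (IsoClass R) where
  add := Quotient.map₂ (fun M N => ⟨M.carrier × N.carrier⟩)
    (fun _ _ ⟨e⟩ _ _ ⟨f⟩ => ⟨LinearEquiv.prodCongr e f⟩)

/-- The class of the zero module. -/
instance : Zero (IsoClass R) where
  zero := Quotient.mk _ ⟨PUnit⟩

/-- Isomorphism classes form a commutative monoid under direct sum. -/
instance : AddCommMonoid (IsoClass R) where
  add_assoc := by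
    rintro ⟨M⟩ ⟨N⟩ ⟨L⟩
    exact Quotient.sound ⟨LinearEquiv.prodAssoc R M.carrier N.carrier L.carrier⟩
  add_comm := by
    rintro ⟨M⟩ ⟨N⟩
    exact Quotient.sound ⟨LinearEquiv.prodComm R M.carrier N.carrier⟩
  zero_add := by
    rintro ⟨M⟩
    exact Quotient.sound ⟨LinearEquiv.uniqueProd⟩
  add_zero := by
    rintro ⟨M⟩
    exact Quotient.sound ⟨LinearEquiv.prodUnique⟩
  nsmul := nsmulRec

end FGProj

/-- `K₀(R)`: the group completion of the monoid of isomorphism classes of finitely generated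
projective left `R`-modules under direct sum. -/
abbrev K0 (R : Type u) [Ring R] : Type (u + 1) := Algebra.GrothendieckAddGroup (FGProj.IsoClass R)

/-- The class `[M]` in `K₀(R)` of a finitely generated projective module `M`. -/
noncomputable def K0.cls (R : Type u) [Ring R] (M : Type u) [AddCommGroup M] [Module R M]
    [Module.Finite R M] [Module.Projective R M] : K0 R :=
  Algebra.GrothendieckAddGroup.of (M := FGProj.IsoClass R) (Quotient.mk (FGProj.isoSetoid R) ⟨M⟩)

/-! ### Modules over the incidence algebra of a finite poset, and their tensor product -/

namespace IncMod

section Basis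

variable (K : Type u) [Field K] {P : Type v} [PartialOrder P]

open scoped Classical in
/-- The basis element `f_{xy}` (`x ≤ y`) of the incidence algebra; it is `0` if `x ≰ y`. -/
noncomputable def f (x y : P) : IncidenceAlgebra K P where
  toFun a b := if a = x ∧ b = y ∧ x ≤ y then 1 else 0
  eq_zero_of_not_le' a b h := by
    rw [if_neg]
    rintro ⟨rfl, rfl, h'⟩
    exact h h'

variable [LocallyFiniteOrder P]

theorem f_mul_f {x y z : P} (hxy : x ≤ y) (hyz : y ≤ z) : f K x y * f K y z = f K x z := by
  ext a b hab
  by_cases h : a = x ∧ b = z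
  · obtain ⟨rfl, rfl⟩ := h
    rw [IncidenceAlgebra.mul_apply, Finset.sum_eq_single y]
    · simp [f, hxy, hyz, hxy.trans hyz]
    · intro t _ hty
      simp [f, hty]
    · intro hy
      exact absurd (Finset.mem_Icc.2 ⟨hxy, hyz⟩) hy
  · rw [IncidenceAlgebra.mul_apply, Finset.sum_eq_zero]
    · have : ¬ (a = x ∧ b = z ∧ x ≤ z) := fun h' => h ⟨h'.1, h'.2.1⟩
      simp [f, this]
    · intro t _
      by_cases ha : a = x
      · have hb : b ≠ z := fun hb => h ⟨ha, hb⟩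
        simp [f, hb]
      · simp [f, ha]

end Basis

variable (K : Type u) [Field K] {P : Type v} [PartialOrder P] [Fintype P] [DecidableEq P]
  [LocallyFiniteOrder P]

set_option linter.unusedSectionVars false

section Tensor

variable (M : Type*) [AddCommGroup M] [Module K M] [Module (IncidenceAlgebra K P) M]
  [IsScalarTower K (IncidenceAlgebra K P) M]

/-- The vector space `M_x = f_{xx} M` of the representation `M` at the vertex `x`. -/
noncomputable def comp (x : P) : Submodule K M :=
  LinearMap.range (Algebra.lsmul K K M (f K x x))

/-- The structure map `M_y → M_x` (`x ≤ y`) of the representation `M`: multiplication by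
`f_{xy}`. -/
noncomputable def tr {x y : P} (h : x ≤ y) : comp K M y →ₗ[K] comp K M x :=
  (Algebra.lsmul K K M (f K x y)).restrict (fun m _ => by
    refine ⟨f K x y • m, ?_⟩
    change f K x x • f K x y • m = f K x y • m
    rw [smul_smul, f_mul_f K le_rfl h])

@[simp] theorem coe_tr {x y : P} (h : x ≤ y) (m : comp K M y) :
    (tr K M h m : M) = f K x y • (m : M) := rfl

theorem tr_refl (x : P) : tr K M (le_refl x) = LinearMap.id := by
  ext ⟨m, n, rfl⟩
  simp only [coe_tr, Algebra.lsmul_coe, LinearMap.id_apply]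
  rw [smul_smul, f_mul_f K le_rfl le_rfl]

theorem tr_comp {x y z : P} (h : x ≤ y) (h' : y ≤ z) :
    tr K M h ∘ₗ tr K M h' = tr K M (h.trans h') := by
  ext m
  simp only [LinearMap.comp_apply, coe_tr]
  rw [smul_smul, f_mul_f K h h']

variable (P)
variable (N : Type*) [AddCommGroup N] [Module K N] [Module (IncidenceAlgebra K P) N]
  [IsScalarTower K (IncidenceAlgebra K P) N]

/-- The tensor product of two representations `M`, `N` of the poset `P` over `K`. Its vector space
at the vertex `x` is `M_x ⊗ N_x`. -/
def Tensor : Type _ := ∀ x : P, comp K M x ⊗[K] comp K N x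

noncomputable instance : AddCommGroup (Tensor K P M N) :=
  inferInstanceAs (AddCommGroup (∀ x : P, comp K M x ⊗[K] comp K N x))

noncomputable instance : Module K (Tensor K P M N) :=
  inferInstanceAs (Module K (∀ x : P, comp K M x ⊗[K] comp K N x))

/-- The structure map `M_y ⊗ N_y → M_x ⊗ N_x`, the tensor product of the structure maps of `M` and
`N`; it is set to `0` if `x ≰ y`. -/
noncomputable def tensorTr (x y : P) :
    comp K M y ⊗[K] comp K N y →ₗ[K] comp K M x ⊗[K] comp K N x :=
  open scoped Classical in
  if h : x ≤ y then TensorProduct.map (tr K M h) (tr K N h) else 0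

theorem tensorTr_refl (x : P) : tensorTr K P M N x x = LinearMap.id := by
  rw [tensorTr, dif_pos le_rfl, tr_refl, tr_refl, TensorProduct.map_id]

theorem tensorTr_tensorTr {x y z : P} (h : x ≤ y) (h' : y ≤ z)
    (t : comp K M z ⊗[K] comp K N z) :
    tensorTr K P M N x y (tensorTr K P M N y z t) = tensorTr K P M N x z t := by
  rw [tensorTr, tensorTr, tensorTr, dif_pos h, dif_pos h', dif_pos (h.trans h'),
    ← tr_comp K M h h', ← tr_comp K N h h', TensorProduct.map_comp, LinearMap.comp_apply]

/-- The action on the tensor product: `f_{xy}` acts by `f_{xy} ⊗ f_{xy}`, so that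
`a = ∑ a(x, y) f_{xy}` acts by `(a • t)_x = ∑_y a(x, y) (f_{xy} ⊗ f_{xy}) t_y`. -/
noncomputable instance : SMul (IncidenceAlgebra K P) (Tensor K P M N) where
  smul a t := fun x => ∑ y, a x y • tensorTr K P M N x y (t y)

theorem tensor_smul_apply (a : IncidenceAlgebra K P) (t : Tensor K P M N) (x : P) :
    (a • t) x = ∑ y, a x y • tensorTr K P M N x y (t y) := rfl

noncomputable instance : Module (IncidenceAlgebra K P) (Tensor K P M N) where
  one_smul t := by
    funext x
    rw [tensor_smul_apply, Finset.sum_eq_single x]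
    · rw [tensorTr_refl, IncidenceAlgebra.one_apply, if_pos rfl, one_smul, LinearMap.id_apply]
    · intro y _ hy
      rw [IncidenceAlgebra.one_apply, if_neg (Ne.symm hy), zero_smul]
    · intro h
      exact absurd (Finset.mem_univ x) h
  mul_smul a b t := by
    funext x
    simp only [tensor_smul_apply, map_sum, map_smul, Finset.smul_sum, smul_smul]
    rw [Finset.sum_comm]
    refine Finset.sum_congr rfl fun z _ => ?_
    rw [IncidenceAlgebra.mul_apply, Finset.sum_smul,
      Finset.sum_subset (Finset.subset_univ (Finset.Icc x z))]
    · refine Finset.sum_congr rfl fun y _ => ?_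
      by_cases h : x ≤ y
      · by_cases h' : y ≤ z
        · rw [tensorTr_tensorTr K P M N h h']
        · rw [IncidenceAlgebra.apply_eq_zero_of_not_le h' b, mul_zero, zero_smul, zero_smul]
      · rw [IncidenceAlgebra.apply_eq_zero_of_not_le h a, zero_mul, zero_smul, zero_smul]
    · intro y _ hy
      rw [Finset.mem_Icc, not_and_or] at hy
      rcases hy with h | h
      · rw [IncidenceAlgebra.apply_eq_zero_of_not_le h a, zero_mul, zero_smul]
      · rw [IncidenceAlgebra.apply_eq_zero_of_not_le h b, mul_zero, zero_smul]
  smul_zero a := by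
    funext x
    rw [tensor_smul_apply]
    exact Finset.sum_eq_zero fun y _ => by
      change a x y • tensorTr K P M N x y 0 = 0
      rw [map_zero, smul_zero]
  smul_add a s t := by
    funext x
    change _ = (a • s) x + (a • t) x
    rw [tensor_smul_apply, tensor_smul_apply, tensor_smul_apply, ← Finset.sum_add_distrib]
    refine Finset.sum_congr rfl fun y _ => ?_
    rw [← smul_add, ← map_add]
    rfl
  add_smul a b t := by
    funext x
    change _ = (a • t) x + (b • t) x
    rw [tensor_smul_apply, tensor_smul_apply, tensor_smul_apply, ← Finset.sum_add_distrib]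
    refine Finset.sum_congr rfl fun y _ => ?_
    rw [← add_smul]
    rfl
  zero_smul t := by
    funext x
    rw [tensor_smul_apply]
    exact Finset.sum_eq_zero fun y _ => zero_smul _ _

instance : IsScalarTower K (IncidenceAlgebra K P) (Tensor K P M N) where
  smul_assoc c a t := by
    funext x
    change _ = c • (a • t) x
    rw [tensor_smul_apply, tensor_smul_apply, Finset.smul_sum]
    refine Finset.sum_congr rfl fun y _ => ?_
    rw [smul_smul]
    rfl

end Tensor

/-! ### Projective modules and the Grothendieck ring -/

/-- The indecomposable projective left module `P(x) = I(P, K) f_{xx}`, with basis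
`{f_{zx} | z ≤ x}`. -/
noncomputable def proj (x : P) : Submodule (IncidenceAlgebra K P) (IncidenceAlgebra K P) :=
  Submodule.span (IncidenceAlgebra K P) {f K x x}

instance proj_finite (x : P) : Module.Finite (IncidenceAlgebra K P) (proj K x) := by
  unfold proj
  infer_instance

instance proj_projective (x : P) : Module.Projective (IncidenceAlgebra K P) (proj K x) := by
  refine Module.Projective.of_split (proj K x).subtype
    ((LinearMap.toSpanSingleton (IncidenceAlgebra K P) (IncidenceAlgebra K P)
      (f K x x)).codRestrict (proj K x) fun a => ?_) ?_
  · exact Submodule.smul_mem _ a (Submodule.subset_span rfl)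
  · ext1 ⟨m, hm⟩
    obtain ⟨a, rfl⟩ := Submodule.mem_span_singleton.1 hm
    apply Subtype.ext
    change (a * f K x x) * f K x x = a * f K x x
    rw [mul_assoc, f_mul_f K le_rfl le_rfl]

variable (P)

/-- `K₀(P)` is closed under tensor products: the tensor product of two finitely generated projective
modules over the incidence algebra is again finitely generated and projective. -/
def TensorClosed : Prop :=
  ∀ (M N : Type (max u v)) [AddCommGroup M] [Module K M] [Module (IncidenceAlgebra K P) M]
    [IsScalarTower K (IncidenceAlgebra K P) M] [AddCommGroup N] [Module K N]
    [Module (IncidenceAlgebra K P) N] [IsScalarTower K (IncidenceAlgebra K P) N]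
    [Module.Finite (IncidenceAlgebra K P) M] [Module.Projective (IncidenceAlgebra K P) M]
    [Module.Finite (IncidenceAlgebra K P) N] [Module.Projective (IncidenceAlgebra K P) N],
    Module.Finite (IncidenceAlgebra K P) (Tensor K P M N) ∧
      Module.Projective (IncidenceAlgebra K P) (Tensor K P M N)

/-- A structure of commutative ring with identity on the additive group `K₀(P)` of the incidence
algebra, whose multiplication is induced by the tensor product of representations:
`[M] [N] = [M ⊗ N]`. If `K₀(P)` is closed under tensor products, there is at most one such
structure, because the classes `[M]` generate `K₀(P)`. -/
structure GrothendieckRing where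
  /-- The biadditive multiplication. -/
  mul : K0 (IncidenceAlgebra K P) →+ K0 (IncidenceAlgebra K P) →+ K0 (IncidenceAlgebra K P)
  mul_cls : ∀ (M N : Type (max u v)) [AddCommGroup M] [Module K M] [Module (IncidenceAlgebra K P) M]
    [IsScalarTower K (IncidenceAlgebra K P) M] [AddCommGroup N] [Module K N]
    [Module (IncidenceAlgebra K P) N] [IsScalarTower K (IncidenceAlgebra K P) N]
    [Module.Finite (IncidenceAlgebra K P) M] [Module.Projective (IncidenceAlgebra K P) M]
    [Module.Finite (IncidenceAlgebra K P) N] [Module.Projective (IncidenceAlgebra K P) N]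
    [Module.Finite (IncidenceAlgebra K P) (Tensor K P M N)]
    [Module.Projective (IncidenceAlgebra K P) (Tensor K P M N)],
    mul (K0.cls (IncidenceAlgebra K P) M) (K0.cls (IncidenceAlgebra K P) N) =
      K0.cls (IncidenceAlgebra K P) (Tensor K P M N)
  mul_assoc : ∀ a b c, mul (mul a b) c = mul a (mul b c)
  mul_comm : ∀ a b, mul a b = mul b a
  one : K0 (IncidenceAlgebra K P)
  one_mul : ∀ a, mul one a = a

variable {K P}

/-- The commutative ring given by a ring structure on `K₀(P)`; its addition is that of `K₀(P)`. -/
noncomputable abbrev GrothendieckRing.toCommRing (S : GrothendieckRing K P) :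
    CommRing (K0 (IncidenceAlgebra K P)) :=
  { (inferInstance : AddCommGroup (K0 (IncidenceAlgebra K P))) with
    mul := fun a b => S.mul a b
    one := S.one
    mul_assoc := S.mul_assoc
    mul_comm := S.mul_comm
    one_mul := S.one_mul
    mul_one := fun a => (S.mul_comm a S.one).trans (S.one_mul a)
    left_distrib := fun a b c => map_add (S.mul a) b c
    right_distrib := fun a b c => by
      change S.mul (a + b) c = S.mul a c + S.mul b c
      rw [map_add, AddMonoidHom.add_apply]
    zero_mul := fun a => by
      change S.mul 0 a = 0
      rw [map_zero, AddMonoidHom.zero_apply]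
    mul_zero := fun a => map_zero (S.mul a) }

end IncMod

/-! ### Semilattices as semigroups -/

/-- The semigroup `(P, ∧)` of a meet-semilattice. -/
def MeetSemigroup (P : Type v) : Type v := P

/-- The semigroup `(P, ∨)` of a join-semilattice. -/
def JoinSemigroup (P : Type v) : Type v := P

namespace MeetSemigroup

/-- The element `x`, regarded as an element of the semigroup `(P, ∧)`. -/
def mk {P : Type v} (x : P) : MeetSemigroup P := x

instance {P : Type v} [SemilatticeInf P] : CommSemigroup (MeetSemigroup P) where
  mul := fun x y => ((x : P) ⊓ (y : P) : P)
  mul_assoc := fun x y z => inf_assoc (α := P) x y z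
  mul_comm := fun x y => inf_comm (α := P) x y

end MeetSemigroup

namespace JoinSemigroup

/-- The element `x`, regarded as an element of the semigroup `(P, ∨)`. -/
def mk {P : Type v} (x : P) : JoinSemigroup P := x

instance {P : Type v} [SemilatticeSup P] : CommSemigroup (JoinSemigroup P) where
  mul := fun x y => ((x : P) ⊔ (y : P) : P)
  mul_assoc := fun x y z => sup_assoc (α := P) x y z
  mul_comm := fun x y => sup_comm (α := P) x y

end JoinSemigroup

/-! The space `P(x)_z` is the line spanned by `f_{zx}` when `z ≤ x` and is `0` otherwise, and the
structure maps carry generators to generators. So `P(x) ⊗ P(y)` is a line exactly at the vertices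
`z` below both `x` and `y`, that is, below `x ⊓ y`; this gives `proj_tensor_proj`. A finitely
generated projective module is a retract of a finite sum of modules `P(x)`, and tensoring two such
retractions gives `tensorClosed`.

For the ring structure, dimension vectors map `K₀(P)` to `ℤ^P`. The classes `[P(x)]` generate
`K₀(P)`, because a `P(x)` can be split off any nonzero projective (`exists_proj_retract`,
`closure_range_proj`). Their dimension vectors are the indicators of principal down-sets, a
unitriangular family and hence a basis of `ℤ^P`. So the dimension vector is an isomorphism
(`dimEquiv`). Dimensions multiply under pointwise tensor product, so the pointwise ring structure of
`ℤ^P` transports to `K₀(P)`, and its unit exists even without a greatest element. The product of the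
indicators of the down-sets of `x` and `y` is the indicator of the down-set of `x ⊓ y`, which
identifies the ring with the semigroup ring. The join case is the same statement for the opposite
order. -/

namespace IncMod

set_option linter.unusedSectionVars false

/-! ### Matrix entries and idempotents of the incidence algebra -/

section Basis

variable (K : Type u) [Field K] {P : Type v} [PartialOrder P]

theorem f_apply_of_le {x y : P} (h : x ≤ y) (a b : P) [Decidable (a = x ∧ b = y)] :
    f K x y a b = if a = x ∧ b = y then 1 else 0 := by
  simp [f, h]

theorem f_apply_self {x y : P} (h : x ≤ y) : f K x y x y = 1 := by
  classical simp [f_apply_of_le K h]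

theorem f_eq_zero {x y : P} (h : ¬ x ≤ y) : f K x y = 0 := by
  ext a b _
  simp [f, h]

variable [Fintype P]

theorem sum_apply {ι : Type*} (s : Finset ι) (g : ι → IncidenceAlgebra K P) (a b : P) :
    (∑ i ∈ s, g i) a b = ∑ i ∈ s, g i a b := by
  classical
  induction s using Finset.induction_on with
  | empty => rfl
  | insert i s hi ih =>
    rw [Finset.sum_insert hi, Finset.sum_insert hi, IncidenceAlgebra.add_apply, ih]

variable [DecidableEq P] [LocallyFiniteOrder P]

theorem f_self_mul_apply (x : P) (a : IncidenceAlgebra K P) (z w : P) :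
    (f K x x * a) z w = if z = x then a x w else 0 := by
  rw [IncidenceAlgebra.mul_apply]
  by_cases hz : z = x
  · subst hz
    by_cases hw : z ≤ w
    · rw [Finset.sum_eq_single z]
      · simp [f_apply_self]
      · intro b _ hb
        simp [f_apply_of_le K le_rfl, hb]
      · intro h
        exact absurd (Finset.mem_Icc.2 ⟨le_rfl, hw⟩) h
    · simp [Finset.Icc_eq_empty hw, IncidenceAlgebra.apply_eq_zero_of_not_le hw a]
  · rw [if_neg hz]
    exact Finset.sum_eq_zero fun b _ => by simp [f_apply_of_le K le_rfl, hz]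

theorem mul_f_self_apply (x : P) (a : IncidenceAlgebra K P) (z w : P) :
    (a * f K x x) z w = if w = x then a z x else 0 := by
  rw [IncidenceAlgebra.mul_apply]
  by_cases hw : w = x
  · subst hw
    by_cases hz : z ≤ w
    · rw [Finset.sum_eq_single w]
      · simp [f_apply_self]
      · intro b _ hb
        simp [f_apply_of_le K le_rfl, hb]
      · intro h
        exact absurd (Finset.mem_Icc.2 ⟨hz, le_rfl⟩) h
    · simp [Finset.Icc_eq_empty hz, IncidenceAlgebra.apply_eq_zero_of_not_le hz a]
  · rw [if_neg hw]
    exact Finset.sum_eq_zero fun b _ => by simp [f_apply_of_le K le_rfl, hw]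

/-- Left multiplication by `f_{xx}` keeps only row `x`. This reduces the action of `a` at the vertex
`x` to that of the single `f_{xw}`. -/
theorem f_self_mul (x : P) (a : IncidenceAlgebra K P) :
    f K x x * a = ∑ w, a x w • f K x w := by
  ext z w _
  rw [f_self_mul_apply, sum_apply, Finset.sum_eq_single w]
  · by_cases hw : x ≤ w
    · simp [f_apply_of_le K hw]
    · simp [f_eq_zero K hw, IncidenceAlgebra.apply_eq_zero_of_not_le hw a]
  · intro b _ hb
    by_cases hx : x ≤ b
    · simp [f_apply_of_le K hx, hb.symm]
    · simp [f_eq_zero K hx]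
  · simp

theorem sum_f_self : ∑ x, f K x x = (1 : IncidenceAlgebra K P) := by
  ext z w _
  rw [sum_apply, IncidenceAlgebra.one_apply, Finset.sum_eq_single z]
  · simp [f_apply_of_le K le_rfl, eq_comm]
  · intro b _ hb
    simp [f_apply_of_le K le_rfl, hb.symm]
  · simp

/-- Evaluation at a pair of vertices, as a linear functional on the incidence algebra. -/
def entry (x y : P) : IncidenceAlgebra K P →ₗ[K] K where
  toFun a := a x y
  map_add' _ _ := rfl
  map_smul' _ _ := rfl

instance finite_incidenceAlgebra : Module.Finite K (IncidenceAlgebra K P) :=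
  Module.Finite.of_injective
    (LinearMap.pi fun x => LinearMap.pi fun y => entry K x y :
      IncidenceAlgebra K P →ₗ[K] P → P → K)
    fun _ _ h => IncidenceAlgebra.ext fun x y _ => congrFun (congrFun h x) y

theorem mem_proj {x : P} {a : IncidenceAlgebra K P} : a ∈ proj K x ↔ a * f K x x = a := by
  constructor
  · intro h
    obtain ⟨b, rfl⟩ := Submodule.mem_span_singleton.1 h
    change (b * f K x x) * f K x x = b * f K x x
    rw [mul_assoc, f_mul_f K le_rfl le_rfl]
  · intro h
    exact Submodule.mem_span_singleton.2 ⟨a, h⟩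

theorem apply_eq_zero_of_mem_proj {x : P} {a : IncidenceAlgebra K P} (h : a ∈ proj K x)
    (z : P) {w : P} (hw : w ≠ x) : a z w = 0 := by
  rw [← (mem_proj K).1 h, mul_f_self_apply, if_neg hw]

theorem f_mem_proj {x y : P} : f K x y ∈ proj K y := by
  by_cases h : x ≤ y
  · exact (mem_proj K).2 (f_mul_f K h le_rfl)
  · rw [f_eq_zero K h]
    exact zero_mem _

end Basis

variable (K : Type u) [Field K] {P : Type v} [PartialOrder P] [Fintype P] [DecidableEq P]
  [LocallyFiniteOrder P]

/-! ### Functoriality and dimension of the vertex spaces -/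

section Comp

variable {M : Type*} [AddCommGroup M] [Module K M] [Module (IncidenceAlgebra K P) M]
  [IsScalarTower K (IncidenceAlgebra K P) M]
variable {M' : Type*} [AddCommGroup M'] [Module K M'] [Module (IncidenceAlgebra K P) M']
  [IsScalarTower K (IncidenceAlgebra K P) M']

theorem mem_comp {x : P} {m : M} : m ∈ comp K M x ↔ f K x x • m = m := by
  constructor
  · rintro ⟨n, rfl⟩
    simp only [Algebra.lsmul_coe]
    rw [smul_smul, f_mul_f K le_rfl le_rfl]
  · intro h
    exact ⟨m, h⟩

theorem f_smul_mem_comp (x y : P) (m : M) : f K x y • m ∈ comp K M x := by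
  by_cases h : x ≤ y
  · rw [mem_comp, smul_smul, f_mul_f K le_rfl h]
  · rw [f_eq_zero K h, zero_smul]
    exact zero_mem _

theorem finite_of_finite_incidenceAlgebra [Module.Finite (IncidenceAlgebra K P) M] :
    Module.Finite K M :=
  Module.Finite.trans (IncidenceAlgebra K P) M

/-- The map `M_x → M'_x` induced by a homomorphism of representations. -/
noncomputable def compMap (g : M →ₗ[IncidenceAlgebra K P] M') (x : P) : comp K M x →ₗ[K] comp K M' x :=
  (g.restrictScalars K).restrict fun m hm => by
    rw [mem_comp] at hm ⊢
    rw [LinearMap.restrictScalars_apply, ← map_smul, hm]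

@[simp] theorem coe_compMap (g : M →ₗ[IncidenceAlgebra K P] M') (x : P) (m : comp K M x) :
    (compMap K g x m : M') = g m := rfl

theorem compMap_comp_tr (g : M →ₗ[IncidenceAlgebra K P] M') {x y : P} (h : x ≤ y) :
    compMap K g x ∘ₗ tr K M h = tr K M' h ∘ₗ compMap K g y := by
  ext m
  simp

theorem finrank_comp_congr (e : M ≃ₗ[IncidenceAlgebra K P] M') (x : P) :
    Module.finrank K (comp K M x) = Module.finrank K (comp K M' x) :=
  LinearEquiv.finrank_eq <| LinearEquiv.ofLinearMap (compMap K e.toLinearMap x)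
    (compMap K e.symm.toLinearMap x) (by ext m; simp) (by ext m; simp)

theorem finrank_comp_prod [Module.Finite (IncidenceAlgebra K P) M]
    [Module.Finite (IncidenceAlgebra K P) M'] (x : P) :
    Module.finrank K (comp K (M × M') x) =
      Module.finrank K (comp K M x) + Module.finrank K (comp K M' x) := by
  have := finite_of_finite_incidenceAlgebra K (P := P) (M := M)
  have := finite_of_finite_incidenceAlgebra K (P := P) (M := M')
  rw [← Module.finrank_prod]
  refine LinearEquiv.finrank_eq <| LinearEquiv.ofLinearMap
    (LinearMap.prod (compMap K (LinearMap.fst _ M M') x) (compMap K (LinearMap.snd _ M M') x))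
    (LinearMap.coprod (compMap K (LinearMap.inl _ M M') x) (compMap K (LinearMap.inr _ M M') x))
    ?_ ?_
  · ext m <;> simp
  · ext m <;> simp

end Comp

/-! ### Functoriality and dimension of the tensor product -/

section Tensor

variable {M : Type*} [AddCommGroup M] [Module K M] [Module (IncidenceAlgebra K P) M]
  [IsScalarTower K (IncidenceAlgebra K P) M]
variable {N : Type*} [AddCommGroup N] [Module K N] [Module (IncidenceAlgebra K P) N]
  [IsScalarTower K (IncidenceAlgebra K P) N]
variable {M' : Type*} [AddCommGroup M'] [Module K M'] [Module (IncidenceAlgebra K P) M']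
  [IsScalarTower K (IncidenceAlgebra K P) M']
variable {N' : Type*} [AddCommGroup N'] [Module K N'] [Module (IncidenceAlgebra K P) N']
  [IsScalarTower K (IncidenceAlgebra K P) N']

/-- The tensor product of two homomorphisms of representations. -/
noncomputable def tensorMap (g : M →ₗ[IncidenceAlgebra K P] M')
    (h : N →ₗ[IncidenceAlgebra K P] N') :
    Tensor K P M N →ₗ[IncidenceAlgebra K P] Tensor K P M' N' where
  toFun t := fun x => TensorProduct.map (compMap K g x) (compMap K h x) (t x)
  map_add' s t := funext fun x => map_add _ (s x) (t x)
  map_smul' a t := by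
    funext x
    simp only [RingHom.id_apply, tensor_smul_apply, map_sum, map_smul]
    refine Finset.sum_congr rfl fun y _ => ?_
    by_cases hxy : x ≤ y
    · simp only [tensorTr, dif_pos hxy]
      rw [← LinearMap.comp_apply, ← TensorProduct.map_comp, ← LinearMap.comp_apply,
        ← TensorProduct.map_comp, compMap_comp_tr, compMap_comp_tr]
    · simp [tensorTr, dif_neg hxy]

theorem tensorMap_apply (g : M →ₗ[IncidenceAlgebra K P] M')
    (h : N →ₗ[IncidenceAlgebra K P] N') (t : Tensor K P M N) (x : P) :
    tensorMap K g h t x = TensorProduct.map (compMap K g x) (compMap K h x) (t x) := rfl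

/-- On the product over all vertices `f_{xx}` acts as the projection to coordinate `x`, so
evaluation at `x` is an isomorphism from `(M ⊗ N)_x` to `M_x ⊗ N_x`. -/
theorem finrank_comp_tensor (x : P) :
    Module.finrank K (comp K (Tensor K P M N) x) =
      Module.finrank K (comp K M x) * Module.finrank K (comp K N x) := by
  have key : ∀ (t : Tensor K P M N) (z : P), (f K x x • t) z = if z = x then t z else 0 := by
    intro t z
    rw [tensor_smul_apply, Finset.sum_eq_single z]
    · by_cases h : z = x
      · subst h
        rw [tensorTr_refl]
        simp [f_apply_self]
      · simp [f_apply_of_le K le_rfl, h]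
    · intro y _ hy
      by_cases h : z = x
      · subst h
        simp [f_apply_of_le K le_rfl, hy]
      · simp [f_apply_of_le K le_rfl, h]
    · simp
  rw [← Module.finrank_tensorProduct]
  let ev : comp K (Tensor K P M N) x →ₗ[K] comp K M x ⊗[K] comp K N x :=
    { toFun := fun t => t.1 x, map_add' := fun _ _ => rfl, map_smul' := fun _ _ => rfl }
  refine LinearEquiv.finrank_eq (LinearEquiv.ofBijective ev ⟨?_, ?_⟩)
  · intro s t h
    apply Subtype.ext
    rw [← (mem_comp K).1 s.2, ← (mem_comp K).1 t.2]
    funext z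
    rw [key, key]
    split_ifs with hz
    · subst hz
      exact h
    · rfl
  · intro s
    let t : Tensor K P M N := Pi.single (M := fun z => comp K M z ⊗[K] comp K N z) x s
    refine ⟨⟨f K x x • t, f_smul_mem_comp K x x t⟩, ?_⟩
    change (f K x x • t) x = s
    rw [key, if_pos rfl]
    exact Pi.single_eq_same (M := fun z => comp K M z ⊗[K] comp K N z) x s

end Tensor

/-! ### The vertex spaces of `P(x)` -/

section Proj

/-- The element `f_{zx}` of `P(x)_z`. -/
noncomputable def projGen (z x : P) : comp K (proj K x) z :=
  ⟨⟨f K z x, f_mem_proj K⟩, (mem_comp K).2 <| Subtype.ext <| by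
    -- For `z ≰ x` the generator is `0`, so no order hypothesis is needed in the definition.
    by_cases h : z ≤ x
    · exact f_mul_f K le_rfl h
    · change f K z z * f K z x = f K z x
      rw [f_eq_zero K h, mul_zero]⟩

/-- The coefficient of `f_{zx}` in an element of `P(x)_z`. -/
noncomputable def projCoeff (z x : P) : comp K (proj K x) z →ₗ[K] K :=
  entry K z x ∘ₗ ((proj K x).subtype.restrictScalars K) ∘ₗ (comp K (proj K x) z).subtype

theorem projCoeff_projGen {z x : P} (h : z ≤ x) : projCoeff K z x (projGen K z x) = 1 :=
  f_apply_self K h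

/-- Lying in the vertex space at `z` leaves only row `z`, and lying in `P(x)` leaves only column
`x`, so a single entry survives. For `z ≰ x` this says that the vertex space is zero. -/
theorem projCoeff_smul_projGen {z x : P} (m : comp K (proj K x) z) :
    projCoeff K z x m • projGen K z x = m := by
  obtain ⟨⟨a, ha⟩, hm⟩ := m
  have hm' : f K z z * a = a := congrArg Subtype.val ((mem_comp K).1 hm)
  apply Subtype.ext
  apply Subtype.ext
  change a z x • f K z x = a
  conv_rhs => rw [← hm', f_self_mul]
  rw [Finset.sum_eq_single x]
  · intro b _ hb
    rw [apply_eq_zero_of_mem_proj K ha z hb, zero_smul]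
  · simp

theorem tr_projGen {z w x : P} (h : z ≤ w) (h' : w ≤ x) :
    tr K (proj K x) h (projGen K w x) = projGen K z x :=
  Subtype.ext <| Subtype.ext <| f_mul_f K h h'

theorem finrank_comp_proj (z x : P) [Decidable (z ≤ x)] :
    Module.finrank K (comp K (proj K x) z) = if z ≤ x then 1 else 0 := by
  split_ifs with h
  · refine finrank_eq_one (projGen K z x) ?_ fun m => ⟨_, projCoeff_smul_projGen K m⟩
    intro h0
    have := projCoeff_projGen K h
    rw [h0, map_zero] at this
    exact zero_ne_one this
  · have : Subsingleton (comp K (proj K x) z) := subsingleton_of_forall_eq 0 fun m => by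
      rw [← projCoeff_smul_projGen K m,
        show projCoeff K z x m = 0 from IncidenceAlgebra.apply_eq_zero_of_not_le h _, zero_smul]
    exact Module.finrank_zero_of_subsingleton

end Proj

end IncMod

/-- The maps `i k` and `p k` assemble to exhibit `X` as a retract of the finite product of the `Y
k`. -/
theorem finite_and_projective_of_sum_comp_eq_id {R : Type*} [Ring R] {ι : Type*} [Fintype ι]
    {X : Type*} [AddCommGroup X] [Module R X] {Y : ι → Type*} [∀ k, AddCommGroup (Y k)]
    [∀ k, Module R (Y k)] [∀ k, Module.Finite R (Y k)] [∀ k, Module.Projective R (Y k)]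
    (p : ∀ k, Y k →ₗ[R] X) (i : ∀ k, X →ₗ[R] Y k) (h : ∀ m, ∑ k, p k (i k m) = m) :
    Module.Finite R X ∧ Module.Projective R X := by
  classical
  have hs : (LinearMap.lsum R Y ℕ p) ∘ₗ LinearMap.pi i = LinearMap.id := by
    ext m
    simpa [LinearMap.lsum_apply] using h m
  refine ⟨Module.Finite.of_surjective (LinearMap.lsum R Y ℕ p)
    fun m => ⟨_, LinearMap.congr_fun hs m⟩, ?_⟩
  have : Module.Projective R (∀ k, Y k) :=
    Module.Projective.of_equiv (DirectSum.linearEquivFunOnFintype R ι Y)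
  exact Module.Projective.of_split _ _ hs

namespace IncMod

set_option linter.unusedSectionVars false

variable (K : Type u) [Field K] {P : Type v} [Fintype P] [DecidableEq P]

/-! ### Tensor products of the modules `P(x)` -/

section Inf

variable [SemilatticeInf P] [LocallyFiniteOrder P]

/-- The element `t = f_{wx} ⊗ f_{wy}`, placed at the vertex `w = x ⊓ y`, generates the tensor
product. The isomorphism from `P(w)` is `a ↦ a • t`, whose value at `z` is the entry `a z w` times
the generator at `z`. -/
theorem proj_tensor_proj (x y : P) :
    Nonempty (Tensor K P (proj K x) (proj K y) ≃ₗ[IncidenceAlgebra K P] proj K (x ⊓ y)) := by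
  set w := x ⊓ y with hw
  let V : P → Type _ := fun z => comp K (proj K x) z ⊗[K] comp K (proj K y) z
  let t : Tensor K P (proj K x) (proj K y) :=
    Pi.single (M := V) w (projGen K w x ⊗ₜ[K] projGen K w y)
  have smul_t : ∀ (a : IncidenceAlgebra K P) (z : P),
      (a • t) z = a z w • (projGen K z x ⊗ₜ[K] projGen K z y) := by
    intro a z
    rw [tensor_smul_apply, Finset.sum_eq_single w]
    · rw [show t w = projGen K w x ⊗ₜ[K] projGen K w y from Pi.single_eq_same (M := V) w _]
      by_cases h : z ≤ w
      · rw [tensorTr, dif_pos h, TensorProduct.map_tmul, tr_projGen K h inf_le_left,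
          tr_projGen K h inf_le_right]
      · rw [IncidenceAlgebra.apply_eq_zero_of_not_le h, zero_smul, zero_smul]
    · intro b _ hb
      rw [show t b = 0 from Pi.single_eq_of_ne (M := V) hb _, map_zero, smul_zero]
    · exact fun h => absurd (Finset.mem_univ w) h
  let g : proj K w →ₗ[IncidenceAlgebra K P] Tensor K P (proj K x) (proj K y) :=
    LinearMap.toSpanSingleton _ _ t ∘ₗ (proj K w).subtype
  have g_apply : ∀ a, g a = a.1 • t := fun _ => rfl
  refine ⟨(LinearEquiv.ofBijective g ⟨?_, ?_⟩).symm⟩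
  · rw [← LinearMap.ker_eq_bot, LinearMap.ker_eq_bot']
    intro a ha
    apply Subtype.ext
    ext z b hzb
    by_cases hb : b = w
    · subst hb
      have h1 : a.1 z w • (projGen K z x ⊗ₜ[K] projGen K z y) = 0 := by
        rw [← smul_t, ← g_apply, ha]
        rfl
      -- For `z ≤ w` the product of the two coefficient functionals is `1` on the generator, so it
      -- reads off the entry `a z w`.
      have h2 := congrArg ((TensorProduct.lid K K).toLinearMap ∘ₗ
        TensorProduct.map (projCoeff K z x) (projCoeff K z y)) h1
      simpa [projCoeff_projGen K (hzb.trans inf_le_left),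
        projCoeff_projGen K (hzb.trans inf_le_right)] using h2
    · exact apply_eq_zero_of_mem_proj K a.2 z hb
  · intro s
    have span : ∀ z, ∃ c : K, s z = c • (projGen K z x ⊗ₜ[K] projGen K z y) := by
      intro z
      generalize s z = r
      induction r using TensorProduct.induction_on with
      | zero => exact ⟨0, (zero_smul _ _).symm⟩
      | tmul m n =>
        refine ⟨projCoeff K z x m * projCoeff K z y n, ?_⟩
        rw [← TensorProduct.smul_tmul_smul, projCoeff_smul_projGen, projCoeff_smul_projGen]
      | add r r' h h' =>
        obtain ⟨c, rfl⟩ := h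
        obtain ⟨c', rfl⟩ := h'
        exact ⟨c + c', (add_smul _ _ _).symm⟩
    choose c hc using span
    -- The preimage is the column `w` with entries `c z`; terms with `z ≰ w` vanish because `f K z w
    -- = 0` there.
    refine ⟨⟨∑ z, c z • f K z w, sum_mem fun z _ =>
      Submodule.smul_of_tower_mem _ _ (f_mem_proj K)⟩, ?_⟩
    funext z
    rw [g_apply, smul_t, hc]
    by_cases h : z ≤ w
    · congr 1
      rw [sum_apply, Finset.sum_eq_single z]
      · simp [f_apply_self K h]
      · intro b _ hb
        by_cases hbw : b ≤ w
        · simp [f_apply_of_le K hbw, hb.symm]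
        · simp [f_eq_zero K hbw]
      · simp
    -- Outside the down-set of `w`, one of the two factors is already `0`.
    · have : projGen K z x ⊗ₜ[K] projGen K z y = 0 := by
        rw [hw, le_inf_iff, not_and_or] at h
        rcases h with h | h
        · rw [show projGen K z x = 0 from Subtype.ext (Subtype.ext (f_eq_zero K h)),
            TensorProduct.zero_tmul]
        · rw [show projGen K z y = 0 from Subtype.ext (Subtype.ext (f_eq_zero K h)),
            TensorProduct.tmul_zero]
      rw [this, smul_zero, smul_zero]

end Inf

/-! ### Projectives as retracts, and closure under tensor products -/

section Order

variable [PartialOrder P] [LocallyFiniteOrder P]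

/-- The identity of a finitely generated projective representation factors through a finite direct
sum of the modules `P(x)`. -/
theorem exists_sum_comp_eq_id (M : Type*) [AddCommGroup M] [Module (IncidenceAlgebra K P) M]
    [Module.Finite (IncidenceAlgebra K P) M] [Module.Projective (IncidenceAlgebra K P) M] :
    ∃ (n : ℕ) (p : ∀ k : Fin n × P, proj K k.2 →ₗ[IncidenceAlgebra K P] M)
      (i : ∀ k : Fin n × P, M →ₗ[IncidenceAlgebra K P] proj K k.2),
      ∑ k, p k ∘ₗ i k = LinearMap.id := by
  obtain ⟨n, φ, g, -, -, h⟩ :=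
    Module.Finite.exists_comp_eq_id_of_projective (IncidenceAlgebra K P) M
  -- `M` is a retract of a free module of rank `n`, and each free summand splits by `a = ∑ a *
  -- f_{ww}`, since the `f_{ww}` sum to `1`.
  refine ⟨n, fun k => φ ∘ₗ LinearMap.single _ _ k.1 ∘ₗ (proj K k.2).subtype, fun k =>
    (LinearMap.toSpanSingleton _ _ (⟨f K k.2 k.2, f_mem_proj K⟩ : proj K k.2)) ∘ₗ
      LinearMap.proj k.1 ∘ₗ g, ?_⟩
  ext m
  have key : ∀ j, ∑ w : P, φ (Pi.single j (g m j * f K w w)) = φ (Pi.single j (g m j)) := by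
    intro j
    have := map_sum (φ ∘ₗ LinearMap.single (IncidenceAlgebra K P)
      (fun _ : Fin n => IncidenceAlgebra K P) j) (fun w => g m j * f K w w) Finset.univ
    rw [← Finset.mul_sum, sum_f_self, mul_one] at this
    exact this.symm
  rw [LinearMap.sum_apply, Fintype.sum_prod_type]
  refine (Finset.sum_congr rfl fun j _ => key j).trans ?_
  rw [← map_sum, Finset.univ_sum_single]
  exact LinearMap.congr_fun h m

end Order

/-- Write the identities of `M` and `N` as `∑ p k ∘ i k` and `∑ q l ∘ j l`. By bilinearity the
identity of `M ⊗ N` is the sum of the `(p k ⊗ q l) ∘ (i k ⊗ j l)`, and each term factors through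
some `P(x) ⊗ P(y) ≅ P(x ⊓ y)`. -/
theorem tensorClosed [SemilatticeInf P] [LocallyFiniteOrder P] : TensorClosed K P := by
  intro M N _ _ _ _ _ _ _ _ _ _ _ _
  obtain ⟨m, p, i, hM⟩ := exists_sum_comp_eq_id K (P := P) M
  obtain ⟨n, q, j, hN⟩ := exists_sum_comp_eq_id K (P := P) N
  have e := fun x y : P => (proj_tensor_proj K x y).some
  refine finite_and_projective_of_sum_comp_eq_id (ι := (Fin m × P) × (Fin n × P))
    (Y := fun k => proj K (k.1.2 ⊓ k.2.2))
    (fun k => tensorMap K (p k.1) (q k.2) ∘ₗ (e k.1.2 k.2.2).symm.toLinearMap)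
    (fun k => (e k.1.2 k.2.2).toLinearMap ∘ₗ tensorMap K (i k.1) (j k.2)) fun t => ?_
  simp only [LinearMap.comp_apply, LinearEquiv.coe_coe, LinearEquiv.symm_apply_apply]
  have eval : ∀ (s : Finset ((Fin m × P) × (Fin n × P)))
      (F : (Fin m × P) × (Fin n × P) → Tensor K P M N) (z : P),
      (∑ k ∈ s, F k) z = ∑ k ∈ s, F k z := fun s F z => Finset.sum_apply z s F
  funext z
  rw [eval]
  simp only [tensorMap_apply]
  generalize t z = r
  have hM' : ∀ a : comp K M z, ∑ k, compMap K (p k) z (compMap K (i k) z a) = a := fun a =>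
    Subtype.ext <| by simpa using LinearMap.congr_fun hM a.1
  have hN' : ∀ a : comp K N z, ∑ k, compMap K (q k) z (compMap K (j k) z a) = a := fun a =>
    Subtype.ext <| by simpa using LinearMap.congr_fun hN a.1
  induction r using TensorProduct.induction_on with
  | zero => simp
  | tmul a b =>
    simp only [TensorProduct.map_tmul]
    rw [Fintype.sum_prod_type]
    conv_rhs => rw [← hM' a, ← hN' b, TensorProduct.sum_tmul]
    exact Finset.sum_congr rfl fun _ _ => by rw [TensorProduct.tmul_sum]
  | add r s hr hs =>
    simp only [map_add, Finset.sum_add_distrib, hr, hs]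

end IncMod

/-- The isomorphism class of a finitely generated projective module. -/
def FGProj.isoClass (R M : Type u) [Ring R] [AddCommGroup M] [Module R M] [Module.Finite R M]
    [Module.Projective R M] : FGProj.IsoClass R :=
  Quotient.mk (FGProj.isoSetoid R) ⟨M⟩

namespace IncMod

set_option linter.unusedSectionVars false

variable (K : Type u) [Field K] {P : Type v} [PartialOrder P] [Fintype P] [DecidableEq P]
  [LocallyFiniteOrder P]

/-! ### Splitting projectives into modules `P(x)` -/

section Decomposition

variable (M : Type*) [AddCommGroup M] [Module K M] [Module (IncidenceAlgebra K P) M]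
  [IsScalarTower K (IncidenceAlgebra K P) M]

/-- A nonzero projective representation has one of the modules `P(x)` as a retract. -/
theorem exists_proj_retract [Module.Finite (IncidenceAlgebra K P) M]
    [Module.Projective (IncidenceAlgebra K P) M] [Nontrivial M] :
    ∃ (x : P) (i : proj K x →ₗ[IncidenceAlgebra K P] M)
      (q : M →ₗ[IncidenceAlgebra K P] proj K x), q ∘ₗ i = LinearMap.id := by
  obtain ⟨n, φ, g, -, -, h⟩ :=
    Module.Finite.exists_comp_eq_id_of_projective (IncidenceAlgebra K P) M
  have hne : {x : P | ∃ m : M, f K x x • m ≠ 0}.Nonempty := by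
    by_contra hcon
    obtain ⟨m, hm⟩ := exists_ne (0 : M)
    apply hm
    rw [← one_smul (IncidenceAlgebra K P) m, ← sum_f_self, Finset.sum_smul]
    refine Finset.sum_eq_zero fun x _ => ?_
    by_contra hx
    exact hcon ⟨x, m, hx⟩
  -- Take `x` maximal with `M_x ≠ 0`. Every `f_{xw}` with `w ≠ x` then kills `M`, so at the vertex
  -- `x` an element `a` acts through the scalar `a x x`.
  obtain ⟨x, ⟨m', hm'⟩, hmax⟩ := (Set.toFinite _).exists_maximal hne
  set m := f K x x • m' with hm
  have hxm : f K x x • m = m := by rw [hm, smul_smul, f_mul_f K le_rfl le_rfl]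
  have vanish : ∀ (w : P), w ≠ x → ∀ n : M, f K x w • n = 0 := by
    intro w hw n
    by_cases hxw : x ≤ w
    · rw [← f_mul_f K hxw le_rfl, mul_smul]
      by_cases hn : f K w w • n = 0
      · rw [hn, smul_zero]
      · exact absurd (le_antisymm (hmax ⟨n, hn⟩ hxw) hxw) hw
    · rw [f_eq_zero K hxw, zero_smul]
  have expand : ∀ (a : IncidenceAlgebra K P) (n : M),
      f K x x • a • n = a x x • f K x x • n := by
    intro a n
    rw [smul_smul, f_self_mul, Finset.sum_smul, Finset.sum_eq_single x]
    · rw [smul_assoc]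
    · intro w _ hw
      rw [smul_assoc, vanish w hw, smul_zero]
    · simp
  -- If all these entries vanished, then expanding `m` in the generators `φ (Pi.single j 1)` and
  -- applying `f_{xx}` would give `m = 0`.
  obtain ⟨j, hj⟩ : ∃ j, g m j x x ≠ 0 := by
    by_contra! hcon
    apply hm'
    rw [← hxm, ← LinearMap.id_apply (R := IncidenceAlgebra K P) m, ← h, LinearMap.comp_apply,
      ← Finset.univ_sum_single (g m), map_sum, Finset.smul_sum]
    refine Finset.sum_eq_zero fun j _ => ?_
    have : φ (Pi.single j (g m j)) = g m j • φ (Pi.single j 1) := by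
      rw [← map_smul, ← Pi.single_smul, smul_eq_mul, mul_one]
    rw [this, expand, hcon, zero_smul]
  set c := g m j x x with hc
  refine ⟨x, LinearMap.toSpanSingleton _ _ m ∘ₗ (proj K x).subtype,
    LinearMap.toSpanSingleton _ _ (c⁻¹ • (⟨f K x x, f_mem_proj K⟩ : proj K x)) ∘ₗ
      LinearMap.proj j ∘ₗ g, ?_⟩
  ext a : 2
  -- Since `f_{xx} m = m`, the coordinate `g m j` lives in row `x`; multiplying by `f_{xx}` on the
  -- right keeps only the entry `c`. The factor `c⁻¹` in the retraction cancels it.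
  have hgm : g m j * f K x x = c • f K x x := by
    have h1 : f K x x * g m j = g m j := by
      conv_rhs => rw [← hxm, map_smul]
      rfl
    ext z w _
    rw [mul_f_self_apply, ← h1, f_self_mul_apply, IncidenceAlgebra.constSMul_apply,
      f_apply_of_le K le_rfl]
    by_cases hz : z = x <;> by_cases hw : w = x <;> simp [hz, hw, hc]
  change (g (a.1 • m)) j * (c⁻¹ • f K x x) = a.1
  rw [map_smul, Pi.smul_apply, smul_eq_mul, mul_assoc, mul_smul_comm, hgm, smul_smul,
    inv_mul_cancel₀ hj, one_smul, (mem_proj K).1 a.2]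

end Decomposition

variable (P)

/-- Every finitely generated projective representation is isomorphic to a direct sum of modules
`P(x)`. -/
theorem closure_range_proj :
    AddSubmonoid.closure (Set.range fun x : P =>
      FGProj.isoClass (IncidenceAlgebra K P) (proj K x)) = ⊤ := by
  set C := AddSubmonoid.closure (Set.range fun x : P =>
      FGProj.isoClass (IncidenceAlgebra K P) (proj K x)) with hC
  have key : ∀ (n : ℕ) (M : Type (max u v)) [AddCommGroup M] [Module K M]
      [Module (IncidenceAlgebra K P) M] [IsScalarTower K (IncidenceAlgebra K P) M]
      [Module.Finite (IncidenceAlgebra K P) M] [Module.Projective (IncidenceAlgebra K P) M],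
      Module.finrank K M = n →
      FGProj.isoClass (IncidenceAlgebra K P) M ∈ C := by
    intro n
    -- Induction on the `K`-dimension: a nonzero `M` is `P(x) ⊕ ker q`, and the kernel is smaller
    -- because `q` is nonzero on the image of `f_{xx}`.
    induction n using Nat.strong_induction_on with
    | _ n ih =>
    intro M _ _ _ _ _ _ hn
    rcases subsingleton_or_nontrivial M with hM | hM
    · have : FGProj.isoClass (IncidenceAlgebra K P) M = 0 :=
        Quotient.sound ⟨⟨0, 0, fun _ => Subsingleton.elim _ _, fun _ => rfl⟩⟩
      rw [this]
      exact zero_mem C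
    · obtain ⟨x, i, q, hq⟩ := exists_proj_retract K (P := P) M
      have hq' : ∀ a, q (i a) = a := LinearMap.congr_fun hq
      let N := LinearMap.ker q
      let r : M →ₗ[IncidenceAlgebra K P] N :=
        (LinearMap.id - i ∘ₗ q).codRestrict N fun m => by simp [N, hq']
      have hr : ∀ m : N, r m = m := fun m => Subtype.ext <| by
        change m.1 - i (q m.1) = m.1
        rw [show q m.1 = 0 from m.2, map_zero, sub_zero]
      have : Module.Finite (IncidenceAlgebra K P) N :=
        Module.Finite.of_surjective r fun m => ⟨m, hr m⟩
      have : Module.Projective (IncidenceAlgebra K P) N :=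
        Module.Projective.of_split N.subtype r (LinearMap.ext hr)
      have : Module.Finite K M := finite_of_finite_incidenceAlgebra K (P := P)
      have hlt : Module.finrank K N < n := by
        rw [← hn]
        refine Submodule.finrank_lt (s := N.restrictScalars K) fun htop => ?_
        have hmem : i ⟨f K x x, f_mem_proj K⟩ ∈ N.restrictScalars K := htop ▸ Submodule.mem_top
        have h0 : q (i ⟨f K x x, f_mem_proj K⟩) = 0 := hmem
        rw [hq'] at h0
        have h1 : f K x x x x = 0 := by
          rw [show f K x x = 0 from congrArg Subtype.val h0]
          rfl
        exact one_ne_zero ((f_apply_self K le_rfl).symm.trans h1)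
      have hsum : FGProj.isoClass (IncidenceAlgebra K P) M =
          FGProj.isoClass (IncidenceAlgebra K P) (proj K x) +
          FGProj.isoClass (IncidenceAlgebra K P) N := by
        refine Quotient.sound ⟨LinearEquiv.ofLinearMap (LinearMap.prod q r)
          (LinearMap.coprod i N.subtype) ?_ ?_⟩
        · refine LinearMap.ext fun a => Prod.ext ?_ (Subtype.ext ?_)
          · change q (i a.1 + a.2.1) = a.1
            rw [map_add, hq', show q a.2.1 = 0 from a.2.2, add_zero]
          · change i a.1 + a.2.1 - i (q (i a.1 + a.2.1)) = a.2.1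
            rw [map_add, hq', show q a.2.1 = 0 from a.2.2, add_zero, add_sub_cancel_left]
        · refine LinearMap.ext fun m => ?_
          change i (q m) + (m - i (q m)) = m
          abel
      rw [hsum]
      exact add_mem (AddSubmonoid.subset_closure ⟨x, rfl⟩) (ih _ hlt N rfl)
  rw [eq_top_iff]
  rintro ⟨M⟩ -
  -- A representative carries only the incidence algebra action; its `K`-structure is recovered by
  -- restriction of scalars.
  let : Module K M.carrier := Module.compHom M.carrier (algebraMap K (IncidenceAlgebra K P))
  have : IsScalarTower K (IncidenceAlgebra K P) M.carrier := IsScalarTower.of_compHom _ _ _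
  exact key _ M.carrier rfl

/-! ### Dimension vectors and the isomorphism of `K₀(P)` with `ℤ^P` -/

/-- The homomorphism `[M] ↦ dim M_x` on isomorphism classes. -/
noncomputable def dimHom (x : P) : FGProj.IsoClass (IncidenceAlgebra K P) →+ ℤ where
  toFun := Quotient.lift
    (fun M =>
      letI : Module K M.carrier := Module.compHom M.carrier (algebraMap K (IncidenceAlgebra K P))
      haveI : IsScalarTower K (IncidenceAlgebra K P) M.carrier := IsScalarTower.of_compHom _ _ _
      (Module.finrank K (comp K M.carrier x) : ℤ))
    fun M N ⟨e⟩ => by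
      let : Module K M.carrier := Module.compHom M.carrier (algebraMap K (IncidenceAlgebra K P))
      have : IsScalarTower K (IncidenceAlgebra K P) M.carrier := IsScalarTower.of_compHom _ _ _
      let : Module K N.carrier := Module.compHom N.carrier (algebraMap K (IncidenceAlgebra K P))
      have : IsScalarTower K (IncidenceAlgebra K P) N.carrier := IsScalarTower.of_compHom _ _ _
      exact congrArg Nat.cast (finrank_comp_congr K e x)
  map_zero' := by
    let : Module K PUnit.{max u v + 1} :=
      Module.compHom PUnit.{max u v + 1} (algebraMap K (IncidenceAlgebra K P))
    have : IsScalarTower K (IncidenceAlgebra K P) PUnit.{max u v + 1} :=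
      IsScalarTower.of_compHom _ _ _
    change (Module.finrank K (comp K PUnit.{max u v + 1} x) : ℤ) = 0
    rw [Module.finrank_zero_of_subsingleton, Nat.cast_zero]
  map_add' := by
    rintro ⟨M⟩ ⟨N⟩
    let : Module K M.carrier := Module.compHom M.carrier (algebraMap K (IncidenceAlgebra K P))
    have : IsScalarTower K (IncidenceAlgebra K P) M.carrier := IsScalarTower.of_compHom _ _ _
    let : Module K N.carrier := Module.compHom N.carrier (algebraMap K (IncidenceAlgebra K P))
    have : IsScalarTower K (IncidenceAlgebra K P) N.carrier := IsScalarTower.of_compHom _ _ _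
    have := congrArg (Nat.cast (R := ℤ))
      (finrank_comp_prod K (M := M.carrier) (M' := N.carrier) x)
    rw [Nat.cast_add] at this
    exact this

/-- The dimension vector `[M] ↦ (dim M_x)_x` on the Grothendieck group. -/
noncomputable def dimVec : K0 (IncidenceAlgebra K P) →+ (P → ℤ) :=
  Algebra.GrothendieckAddGroup.lift (AddMonoidHom.pi (dimHom K P))

/-- `dimHom` uses the `K`-structure restricted from the incidence algebra, a different instance from
the given one. The identity of `M` is linear over the incidence algebra, so `finrank_comp_congr`
compares the two. -/
theorem dimVec_cls (M : Type (max u v)) [AddCommGroup M] [inst : Module K M]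
    [Module (IncidenceAlgebra K P) M] [tower : IsScalarTower K (IncidenceAlgebra K P) M]
    [Module.Finite (IncidenceAlgebra K P) M] [Module.Projective (IncidenceAlgebra K P) M] (x : P) :
    dimVec K P (K0.cls (IncidenceAlgebra K P) M) x = Module.finrank K (comp K M x) := by
  have h : dimVec K P (K0.cls (IncidenceAlgebra K P) M) = AddMonoidHom.pi (dimHom K P)
      (FGProj.isoClass (IncidenceAlgebra K P) M) :=
    DFunLike.congr_fun (Algebra.GrothendieckAddGroup.lift.symm_apply_apply
      (AddMonoidHom.pi (dimHom K P))) _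
  rw [h]
  exact congrArg Nat.cast (@finrank_comp_congr K _ P _ _ _ _ M _
    (Module.compHom M (algebraMap K (IncidenceAlgebra K P))) _ (IsScalarTower.of_compHom _ _ _)
    M _ inst _ tower (LinearEquiv.refl _ M) x)

theorem dimVec_proj (x z : P) [Decidable (z ≤ x)] :
    dimVec K P (K0.cls (IncidenceAlgebra K P) (proj K x)) z = if z ≤ x then 1 else 0 := by
  rw [dimVec_cls, finrank_comp_proj]
  split_ifs <;> rfl

theorem closure_range_cls_proj :
    AddSubgroup.closure (Set.range fun x : P => K0.cls (IncidenceAlgebra K P) (proj K x)) = ⊤ := by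
  set G := AddSubgroup.closure
    (Set.range fun x : P => K0.cls (IncidenceAlgebra K P) (proj K x)) with hG
  have hof : ∀ a : FGProj.IsoClass (IncidenceAlgebra K P),
      Algebra.GrothendieckAddGroup.of a ∈ G := by
    intro a
    have ha : a ∈ AddSubmonoid.closure (Set.range fun x : P =>
      FGProj.isoClass (IncidenceAlgebra K P) (proj K x)) :=
      closure_range_proj K P ▸ AddSubmonoid.mem_top a
    refine AddSubmonoid.closure_le (S := G.toAddSubmonoid.comap
      Algebra.GrothendieckAddGroup.of).2 ?_ ha
    rintro _ ⟨x, rfl⟩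
    exact AddSubgroup.subset_closure ⟨x, rfl⟩
  -- The quotient map by `G` vanishes on classes of modules, hence is zero by the universal property
  -- of the group completion.
  have hid : (QuotientAddGroup.mk' G) = 0 := by
    apply Algebra.GrothendieckAddGroup.lift.symm.injective
    ext a
    exact (QuotientAddGroup.eq_zero_iff _).2 (hof a)
  rw [eq_top_iff]
  intro a _
  exact (QuotientAddGroup.eq_zero_iff a).1 (DFunLike.congr_fun hid a)

/-- The homomorphism `ℤ^P → K₀(P)` that sends the basis vector at `x` to `[P(x)]`. -/
noncomputable def projComb : (P → ℤ) →ₗ[ℤ] K0 (IncidenceAlgebra K P) :=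
  Fintype.linearCombination ℤ fun x => K0.cls (IncidenceAlgebra K P) (proj K x)

theorem projComb_surjective : Function.Surjective (projComb K P) := by
  rw [← LinearMap.range_eq_top, projComb, Fintype.range_linearCombination]
  apply Submodule.toAddSubgroup_injective
  rw [Submodule.span_int_eq_addSubgroupClosure, closure_range_cls_proj]
  rfl

/-- The image contains the indicators of principal down-sets. Subtracting from the one at `x` the
basis vectors at all `y < x` leaves the basis vector at `x`, so well-founded induction yields every
basis vector. -/
theorem dimVec_projComb_surjective :
    Function.Surjective ((dimVec K P).toIntLinearMap ∘ₗ projComb K P) := by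
  classical
  rw [← LinearMap.range_eq_top, eq_top_iff]
  set S := LinearMap.range ((dimVec K P).toIntLinearMap ∘ₗ projComb K P)
  have hmem : ∀ x : P, (fun z => if z ≤ x then (1 : ℤ) else 0) ∈ S := by
    refine fun x => ⟨Pi.single x 1, ?_⟩
    rw [LinearMap.comp_apply, projComb, Fintype.linearCombination_apply_single, one_smul]
    exact funext fun z => dimVec_proj K P x z
  have hsingle : ∀ x : P, (Pi.single x 1 : P → ℤ) ∈ S := by
    intro x
    induction x using WellFoundedLT.induction with
    | _ x ih =>
    have : (Pi.single x 1 : P → ℤ) = (fun z => if z ≤ x then (1 : ℤ) else 0) -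
        ∑ y ∈ Finset.univ.filter (· < x), Pi.single y 1 := by
      funext z
      rw [Pi.sub_apply, Finset.sum_apply, Finset.sum_filter]
      simp only [Pi.single_apply]
      rcases eq_or_ne z x with rfl | hz
      · rw [Finset.sum_eq_zero]
        · simp
        · intro y _
          split_ifs with h1 h2
          · exact absurd h1 (h2 ▸ lt_irrefl _)
          · rfl
          · rfl
      · rw [Finset.sum_eq_single z]
        · by_cases h : z ≤ x
          · simp [hz, h, lt_of_le_of_ne h hz]
          · simp [hz, h, show ¬ z < x from fun h' => h h'.le]
        · intro y _ hy
          simp [hy.symm]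
        · simp
    rw [this]
    exact sub_mem (hmem x) (sum_mem fun y hy => ih y (Finset.mem_filter.1 hy).2)
  intro v _
  rw [← Finset.univ_sum_single v]
  refine sum_mem fun x _ => ?_
  have : (Pi.single x (v x) : P → ℤ) = v x • Pi.single x 1 := by
    rw [← Pi.single_smul, smul_eq_mul, mul_one]
  rw [this]
  exact S.smul_mem _ (hsingle x)

/-- A surjective endomorphism of a finitely generated `ℤ`-module is injective, so linear
independence of the `[P(x)]` needs no separate argument. -/
theorem dimVec_projComb_bijective :
    Function.Bijective ((dimVec K P).toIntLinearMap ∘ₗ projComb K P) :=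
  ⟨OrzechProperty.injective_of_surjective_endomorphism _ (dimVec_projComb_surjective K P),
    dimVec_projComb_surjective K P⟩

/-- The dimension vector is an isomorphism `K₀(P) ≃ ℤ^P`. -/
noncomputable def dimEquiv : K0 (IncidenceAlgebra K P) ≃+ (P → ℤ) :=
  AddEquiv.ofBijective (dimVec K P) <| by
    refine ⟨fun a b hab => ?_, fun v => ?_⟩
    · obtain ⟨a, rfl⟩ := projComb_surjective K P a
      obtain ⟨b, rfl⟩ := projComb_surjective K P b
      rw [(dimVec_projComb_bijective K P).1 hab]
    · obtain ⟨w, hw⟩ := dimVec_projComb_surjective K P v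
      exact ⟨_, hw⟩

/-- The ring structure on `K₀(P)` for which dimension vectors are multiplied pointwise. -/
noncomputable def grothendieckRing : GrothendieckRing K P where
  mul := (AddMonoidHom.compHom (dimEquiv K P).symm.toAddMonoidHom).comp
    ((AddMonoidHom.compHom.flip (dimEquiv K P).toAddMonoidHom).comp
      (AddMonoidHom.mul.comp (dimEquiv K P).toAddMonoidHom))
  mul_cls M N _ _ _ _ _ _ _ _ _ _ _ _ _ _ := by
    refine (dimEquiv K P).symm_apply_eq.2 (funext fun x => ?_)
    change dimVec K P _ x * dimVec K P _ x = dimVec K P _ x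
    rw [dimVec_cls, dimVec_cls, dimVec_cls, finrank_comp_tensor, Nat.cast_mul]
  mul_assoc a b c := by simp [mul_assoc]
  mul_comm a b := by simp [mul_comm]
  -- The unit is the class with dimension `1` at every vertex; it need not be some `[P(x)]`.
  one := (dimEquiv K P).symm 1
  one_mul a := by simp

end IncMod

/-! ### Comparison with the semigroup ring -/

namespace IncMod

variable (K : Type u) [Field K] {P : Type v} [SemilatticeInf P] [Fintype P] [DecidableEq P]
  [LocallyFiniteOrder P]

/-- The Grothendieck ring of a finite meet-semilattice is the semigroup ring of any magma `G`
isomorphic to `(P, ∧)`. -/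
theorem exists_grothendieckRing_equiv {G : Type v} [Mul G] (e : G ≃ P)
    (he : ∀ a b, e (a * b) = e a ⊓ e b) :
    ∃ S : GrothendieckRing K P,
      letI : CommRing (K0 (IncidenceAlgebra K P)) := S.toCommRing
      ∃ Φ : MonoidAlgebra ℤ G ≃+* K0 (IncidenceAlgebra K P),
        ∀ g : G, Φ (MonoidAlgebra.single g 1) =
          K0.cls (IncidenceAlgebra K P) (proj K (e g)) := by
  classical
  -- `L` sends `g` to the indicator of the down-set of `e g`, so multiplicativity can be checked
  -- pointwise in `ℤ^P`.
  let L : MonoidAlgebra ℤ G ≃ₗ[ℤ] (P → ℤ) :=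
    (MonoidAlgebra.coeffLinearEquiv ℤ).trans <|
      (Finsupp.domLCongr e).trans <| (Finsupp.linearEquivFunOnFinite ℤ ℤ P).trans <|
        LinearEquiv.ofBijective _ (dimVec_projComb_bijective K P)
  have L_one : ∀ g, L (MonoidAlgebra.single g 1) =
      dimVec K P (K0.cls (IncidenceAlgebra K P) (proj K (e g))) := by
    intro g
    change dimVec K P (projComb K P (Finsupp.linearEquivFunOnFinite ℤ ℤ P
      (Finsupp.domLCongr e (Finsupp.single g 1)))) = _
    rw [Finsupp.domLCongr_single, Finsupp.linearEquivFunOnFinite_single, projComb,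
      Fintype.linearCombination_apply_single, one_smul]
  have L_single : ∀ g (n : ℤ) z,
      L (MonoidAlgebra.single g n) z = n * if z ≤ e g then 1 else 0 := by
    intro g n z
    have : (MonoidAlgebra.single g n : MonoidAlgebra ℤ G) = n • MonoidAlgebra.single g 1 := by
      simp
    rw [this, map_smul, L_one, Pi.smul_apply, dimVec_proj, smul_eq_mul]
  -- On basis elements this is `z ≤ x ⊓ y ↔ z ≤ x ∧ z ≤ y`, the intersection of two principal
  -- down-sets.
  have L_mul : ∀ a b, L (a * b) = L a * L b := by
    intro a b
    induction a using MonoidAlgebra.induction_linear with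
    | zero => simp
    | add a a' h h' => rw [add_mul, map_add, map_add, add_mul, h, h']
    | single g n =>
      induction b using MonoidAlgebra.induction_linear with
      | zero => simp
      | add b b' h h' => rw [mul_add, map_add, map_add, mul_add, h, h']
      | single g' n' =>
        rw [MonoidAlgebra.single_mul_single]
        funext z
        rw [Pi.mul_apply, L_single, L_single, L_single, he]
        by_cases h : z ≤ e g <;> by_cases h' : z ≤ e g' <;> simp [h, h']
  refine ⟨grothendieckRing K P, ?_⟩
  let : CommRing (K0 (IncidenceAlgebra K P)) := (grothendieckRing K P).toCommRing
  refine ⟨{ L.toAddEquiv.trans (dimEquiv K P).symm with map_mul' := fun a b => ?_ }, fun g => ?_⟩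
  · change (dimEquiv K P).symm (L (a * b)) = (dimEquiv K P).symm
      (dimEquiv K P ((dimEquiv K P).symm (L a)) * dimEquiv K P ((dimEquiv K P).symm (L b)))
    rw [AddEquiv.apply_symm_apply, AddEquiv.apply_symm_apply, L_mul]
  · change (dimEquiv K P).symm (L (MonoidAlgebra.single g 1)) = _
    rw [L_one]
    exact (dimEquiv K P).symm_apply_apply _

end IncMod

theorem proposition7 (K : Type u) [Field K] :
    -- meet-semilattices
    (∀ (P : Type v) [SemilatticeInf P] [Fintype P] [DecidableEq P] [LocallyFiniteOrder P],
      (∀ x y : P, Nonempty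
        (IncMod.Tensor K P (IncMod.proj K x) (IncMod.proj K y)
          ≃ₗ[IncidenceAlgebra K P] IncMod.proj K (x ⊓ y))) ∧
      IncMod.TensorClosed K P ∧
      ∃ S : IncMod.GrothendieckRing K P,
        letI : CommRing (K0 (IncidenceAlgebra K P)) := S.toCommRing
        ∃ Φ : MonoidAlgebra ℤ (MeetSemigroup P) ≃+* K0 (IncidenceAlgebra K P),
          ∀ x : P, Φ (MonoidAlgebra.single (MeetSemigroup.mk x) 1) =
            K0.cls (IncidenceAlgebra K P) (IncMod.proj K x)) ∧
    -- join-semilattices, via the incidence algebra of the opposite poset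
    (∀ (Q : Type v) [SemilatticeSup Q] [Fintype Q] [DecidableEq Q] [LocallyFiniteOrder Q],
      (∀ x y : Q, Nonempty
        (IncMod.Tensor K Qᵒᵈ (IncMod.proj K (OrderDual.toDual x))
            (IncMod.proj K (OrderDual.toDual y))
          ≃ₗ[IncidenceAlgebra K Qᵒᵈ] IncMod.proj K (OrderDual.toDual (x ⊔ y)))) ∧
      IncMod.TensorClosed K Qᵒᵈ ∧
      ∃ S : IncMod.GrothendieckRing K Qᵒᵈ,
        letI : CommRing (K0 (IncidenceAlgebra K Qᵒᵈ)) := S.toCommRing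
        ∃ Φ : MonoidAlgebra ℤ (JoinSemigroup Q) ≃+* K0 (IncidenceAlgebra K Qᵒᵈ),
          ∀ x : Q, Φ (MonoidAlgebra.single (JoinSemigroup.mk x) 1) =
            K0.cls (IncidenceAlgebra K Qᵒᵈ) (IncMod.proj K (OrderDual.toDual x))) := by

  refine ⟨fun P _ _ _ _ => ⟨IncMod.proj_tensor_proj K, IncMod.tensorClosed K, ?_⟩,
    fun Q _ _ _ _ => ⟨fun x y => IncMod.proj_tensor_proj K (OrderDual.toDual x)
      (OrderDual.toDual y), IncMod.tensorClosed K, ?_⟩⟩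
  · exact IncMod.exists_grothendieckRing_equiv K (G := MeetSemigroup P) (Equiv.refl P)
      fun _ _ => rfl
  -- The meet of `Qᵒᵈ` is by definition the join of `Q`.
  · exact IncMod.exists_grothendieckRing_equiv K (P := Qᵒᵈ) (G := JoinSemigroup Q)
      OrderDual.toDual fun _ _ => rfl
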